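/- For a connected simple graph $G$ on $n \ge 2$ vertices let $\mu_1(G) \ge \mu_2(G) \ge \dots \ge \mu_{n-1}(G) \ge \mu_n(G) = 0$ be the eigenvalues, with multiplicity, of its Laplacian matrix $L(G) = D(G) - A(G)$, where $D(G)$ is the diagonal matrix of vertex degrees and $A(G)$ is the adjacency matrix. The Laplacian spectral ratio of $G$ is $$R_L(G) = \frac{\mu_1(G)}{\mu_{n-1}(G)},$$ the quotient of the largest by the second smallest Laplacian eigenvalue. Let $T$ be a tree on $n \ge 6$ vertices, and let $\mathfrak{D}(T)$ be the set of all vertices $v$ of $T$ for which there is a vertex $x$ of $T$ with $d(x,v) \ge 3$, that is, the set of vertices of eccentricity at least $3$. If $|\mathfrak{D}(T)| \le n-1$, then $$R_L(T) < R_L(P_n),$$ where $P_n$ is the path on $n$ vertices. -/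

import Mathlib

noncomputable section

open Classical in
/-- The eigenvalues of the real Laplacian matrix `D(G) - A(G)`, with multiplicity and in
non-increasing order, counted from `0`: `lapEigenvalue G 0` is the largest one and
`lapEigenvalue G (n - 1)` the smallest one, where `n` is the number of vertices.
(Indices `i ≥ n` get the dummy value `0`.) -/
def lapEigenvalue {V : Type*} [Fintype V] (G : SimpleGraph V) (i : ℕ) : ℝ :=
  if h : i < Fintype.card V then
    (G.isHermitian_lapMatrix (R := ℝ)).eigenvalues₀ ⟨i, h⟩
  else 0

/-- The Laplacian spectral ratio of a connected graph on `n ≥ 2` vertices: the largest Laplacian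
eigenvalue divided by the second smallest one (the algebraic connectivity). -/
def laplacianSpectralRatio {V : Type*} [Fintype V] (G : SimpleGraph V) : ℝ :=
  lapEigenvalue G 0 / lapEigenvalue G (Fintype.card V - 2)

/-- The set of the vertices `v` of `G` for which there is a vertex at distance at least `3`
from `v`, that is, of the vertices of eccentricity at least `3`. -/
def eccentricityGeThree {V : Type*} (G : SimpleGraph V) : Set V :=
  {v | ∃ x : V, 3 ≤ G.dist x v}

end

/-! A vertex `v` outside the given set has eccentricity at most two, so the tree is `v`, its `k`
neighbours, and leaves hanging from these. The comparison passes through ρ = (4n² - 5)/10, which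
lies below the ratio of the path because the path has eigenvalues w = 2 - 2cos(π/n) and 4 - w
(`lt_laplacianSpectralRatio_pathGraph`). It suffices that μ₁ ≤ ρ μₙ₋₁.

Let `M` be the largest number of leaves at a neighbour of `v`. Weighted AM-GM on the edges gives μ₁
≤ U with U the larger of k + (n-1)/k and M + 2 + (k-1)/(M+1) (`form_le`). For μₙ₋₁ it is enough to
bound the form below by L = U/ρ on one hyperplane: x_v = 0 if no branch is too heavy, otherwise one
tying x_v to the neighbour with the most leaves (`le_lapEigenvalue_of_numLeaves_le`,
`le_lapEigenvalue_of_sum_le`). The remaining inequality in n, k, M is `exists_spectral_bounds`: a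
finite evaluation for n ≤ 15, estimates for n ≥ 16. -/

/-! ### Eigenvalues of real symmetric matrices from quadratic forms. -/

open Matrix in
theorem Matrix.IsHermitian.exists_eigenvectors₀ {n : Type*} [Fintype n] [DecidableEq n]
    {A : Matrix n n ℝ} (hA : A.IsHermitian) :
    ∃ e : Fin (Fintype.card n) → n → ℝ,
      (∀ i, A *ᵥ e i = hA.eigenvalues₀ i • e i) ∧
      (∀ i j, e i ⬝ᵥ e j = if i = j then 1 else 0) ∧
      (∀ x : n → ℝ, (∀ i, e i ⬝ᵥ x = 0) → x = 0) := by
  -- This is the equivalence used to define `eigenvalues` from `eigenvalues₀`, so the two indexings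
  -- match.
  set σ : Fin (Fintype.card n) ≃ n := Fintype.equivOfCardEq (Fintype.card_fin _) with hσ
  refine ⟨fun i => hA.eigenvectorBasis (σ i), fun i => ?_, fun i j => ?_, fun x hx => ?_⟩
  · have h := hA.mulVec_eigenvectorBasis (σ i)
    have h2 : hA.eigenvalues (σ i) = hA.eigenvalues₀ i := by
      simp [Matrix.IsHermitian.eigenvalues, hσ]
    rw [h2] at h
    exact h
  · have h := orthonormal_iff_ite.mp hA.eigenvectorBasis.orthonormal (σ j) (σ i)
    rw [EuclideanSpace.inner_eq_star_dotProduct] at h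
    simp only [star_trivial, σ.injective.eq_iff] at h
    rw [h]
    simp [eq_comm]
  · have h : WithLp.toLp 2 x = 0 := by
      refine InnerProductSpace.ext_inner_left_basis hA.eigenvectorBasis.toBasis fun i => ?_
      have h := hx (σ.symm i)
      simp only [Equiv.apply_symm_apply] at h
      rw [OrthonormalBasis.coe_toBasis, EuclideanSpace.inner_eq_star_dotProduct]
      simpa [dotProduct_comm] using h
    simpa using h

open Matrix in
theorem Matrix.IsHermitian.eigenvalues₀_le {n : Type*} [Fintype n] [DecidableEq n]
    {A : Matrix n n ℝ} (hA : A.IsHermitian) {U : ℝ}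
    (hU : ∀ x, x ⬝ᵥ A *ᵥ x ≤ U * (x ⬝ᵥ x)) (i : Fin (Fintype.card n)) :
    hA.eigenvalues₀ i ≤ U := by
  obtain ⟨e, he, ho, -⟩ := hA.exists_eigenvectors₀
  have := hU (e i)
  simpa [he, ho] using this

open Matrix in
/-- A lower bound for the quadratic form on a hyperplane bounds every eigenvalue but the last. -/
theorem Matrix.IsHermitian.le_eigenvalues₀ {n : Type*} [Fintype n] [DecidableEq n]
    {A : Matrix n n ℝ} (hA : A.IsHermitian) {μ : ℝ} (l : (n → ℝ) →ₗ[ℝ] ℝ)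
    (hl : ∀ x, l x = 0 → μ * (x ⬝ᵥ x) ≤ x ⬝ᵥ A *ᵥ x) {i j : Fin (Fintype.card n)}
    (hij : i < j) : μ ≤ hA.eigenvalues₀ i := by
  obtain ⟨e, he, ho, -⟩ := hA.exists_eigenvectors₀
  have hji := hA.eigenvalues₀_antitone hij.le
  have key : ∀ a b : ℝ, l (a • e i + b • e j) = 0 →
      μ * (a ^ 2 + b ^ 2) ≤ hA.eigenvalues₀ i * a ^ 2 + hA.eigenvalues₀ j * b ^ 2 := by
    intro a b hab
    have := hl _ hab
    simp only [mulVec_add, mulVec_smul, he, dotProduct_add, add_dotProduct, dotProduct_smul,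
      smul_dotProduct, ho, hij.ne, hij.ne', if_true, if_false, smul_eq_mul] at this
    linarith
  -- The plane of `e i` and `e j` meets the kernel of `l` nontrivially: in `e i`, or in `l (e j) • e
  -- i - l (e i) • e j`.
  by_cases h0 : l (e i) = 0
  · have := key 1 0 (by simp [h0])
    linarith
  · have h1 := key (l (e j)) (-l (e i)) (by simp; ring)
    have h2 : 0 < l (e i) ^ 2 := by positivity
    have h3 : hA.eigenvalues₀ j * (-l (e i)) ^ 2 ≤ hA.eigenvalues₀ i * (-l (e i)) ^ 2 :=
      mul_le_mul_of_nonneg_right hji (sq_nonneg _)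
    by_contra hc
    push Not at hc
    nlinarith [sq_nonneg (l (e j))]

open Matrix in
theorem Matrix.IsHermitian.exists_eigenvalues₀_eq {n : Type*} [Fintype n] [DecidableEq n]
    {A : Matrix n n ℝ} (hA : A.IsHermitian) {μ : ℝ} {x : n → ℝ} (hx : x ≠ 0)
    (h : A *ᵥ x = μ • x) : ∃ i, hA.eigenvalues₀ i = μ := by
  obtain ⟨e, he, ho, hc⟩ := hA.exists_eigenvectors₀
  by_contra! hne
  refine hx (hc x fun i => ?_)
  have h1 : e i ⬝ᵥ A *ᵥ x = (A *ᵥ e i) ⬝ᵥ x := by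
    rw [dotProduct_mulVec, ← mulVec_transpose]
    congr 2
  rw [h, he, dotProduct_smul, smul_dotProduct, smul_eq_mul, smul_eq_mul] at h1
  have : (hA.eigenvalues₀ i - μ) * (e i ⬝ᵥ x) = 0 := by linarith
  exact (mul_eq_zero.mp this).resolve_left (sub_ne_zero.mpr (hne i))

/-! ### Laplacian eigenvalues. -/

open Matrix in
theorem SimpleGraph.dotProduct_lapMatrix_mulVec {V : Type*} [Fintype V] [DecidableEq V]
    (G : SimpleGraph V) [DecidableRel G.Adj] (x : V → ℝ) :
    x ⬝ᵥ G.lapMatrix ℝ *ᵥ x = (∑ i, ∑ j ∈ G.neighborFinset i, (x i - x j) ^ 2) / 2 := by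
  rw [← toLinearMap₂'_apply', SimpleGraph.lapMatrix_toLinearMap₂']
  simp [SimpleGraph.neighborFinset_eq_filter, Finset.sum_filter]

theorem lapEigenvalue_eq {V : Type*} [Fintype V] [DecidableEq V] (G : SimpleGraph V)
    [DecidableRel G.Adj] {i : ℕ} (hi : i < Fintype.card V) :
    lapEigenvalue G i = (G.isHermitian_lapMatrix (R := ℝ)).eigenvalues₀ ⟨i, hi⟩ := by
  rw [lapEigenvalue, dif_pos hi]
  congr!

theorem lapEigenvalue_le {V : Type*} [Fintype V] [DecidableEq V] (G : SimpleGraph V)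
    [DecidableRel G.Adj] {U : ℝ}
    (hU : ∀ x : V → ℝ, (∑ i, ∑ j ∈ G.neighborFinset i, (x i - x j) ^ 2) / 2 ≤ U * ∑ i, x i ^ 2)
    {i : ℕ} (hi : i < Fintype.card V) : lapEigenvalue G i ≤ U := by
  rw [lapEigenvalue_eq G hi]
  refine Matrix.IsHermitian.eigenvalues₀_le _ (fun x => ?_) _
  rw [SimpleGraph.dotProduct_lapMatrix_mulVec]
  simpa [dotProduct, sq] using hU x

theorem le_lapEigenvalue {V : Type*} [Fintype V] [DecidableEq V] (G : SimpleGraph V)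
    [DecidableRel G.Adj] {μ : ℝ} (l : (V → ℝ) →ₗ[ℝ] ℝ)
    (hl : ∀ x : V → ℝ, l x = 0 →
      μ * ∑ i, x i ^ 2 ≤ (∑ i, ∑ j ∈ G.neighborFinset i, (x i - x j) ^ 2) / 2)
    {i : ℕ} (hi : i + 1 < Fintype.card V) : μ ≤ lapEigenvalue G i := by
  rw [lapEigenvalue_eq G (by omega)]
  refine Matrix.IsHermitian.le_eigenvalues₀ _ l (fun x hx => ?_) (j := ⟨i + 1, hi⟩)
    (by simp [Fin.lt_def])
  rw [SimpleGraph.dotProduct_lapMatrix_mulVec]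
  simpa [dotProduct, sq] using hl x hx

open Matrix in
theorem exists_lapEigenvalue_eq {V : Type*} [Fintype V] [DecidableEq V] (G : SimpleGraph V)
    [DecidableRel G.Adj] {μ : ℝ} {x : V → ℝ} (hx : x ≠ 0) (h : G.lapMatrix ℝ *ᵥ x = μ • x) :
    ∃ i < Fintype.card V, lapEigenvalue G i = μ := by
  obtain ⟨i, hi⟩ := (G.isHermitian_lapMatrix (R := ℝ)).exists_eigenvalues₀_eq hx h
  refine ⟨i, i.2, ?_⟩
  rw [lapEigenvalue_eq G i.2, ← hi]

theorem lapEigenvalue_anti {V : Type*} [Fintype V] (G : SimpleGraph V) {i j : ℕ} (hij : i ≤ j)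
    (hj : j < Fintype.card V) : lapEigenvalue G j ≤ lapEigenvalue G i := by
  classical
  rw [lapEigenvalue_eq G hj, lapEigenvalue_eq G (hij.trans_lt hj)]
  exact Matrix.IsHermitian.eigenvalues₀_antitone _ hij

theorem lapEigenvalue_last_nonpos {V : Type*} [Fintype V] (G : SimpleGraph V)
    (h : 0 < Fintype.card V) : lapEigenvalue G (Fintype.card V - 1) ≤ 0 := by
  classical
  have : Nonempty V := Fintype.card_pos_iff.mp h
  obtain ⟨i, hi, hi0⟩ := exists_lapEigenvalue_eq G (μ := 0) (x := fun _ => 1)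
    (fun h => one_ne_zero (congrFun h (Classical.arbitrary V)))
    (by rw [SimpleGraph.lapMatrix_mulVec_const_eq_zero, zero_smul])
  exact (lapEigenvalue_anti G (by omega) (by omega)).trans_eq hi0

-- Otherwise two orthonormal eigenvectors would have nonpositive eigenvalues; on a connected graph
-- both would be constant.
open Matrix in
theorem lapEigenvalue_pos_of_connected {V : Type*} [Fintype V] (G : SimpleGraph V)
    (hG : G.Connected) {i : ℕ} (hi : i + 1 < Fintype.card V) : 0 < lapEigenvalue G i := by
  classical
  have hL := G.isHermitian_lapMatrix (R := ℝ)
  have hi' : i < Fintype.card V := by omega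
  rw [lapEigenvalue_eq G hi']
  by_contra! h
  obtain ⟨e, he, ho, -⟩ := hL.exists_eigenvectors₀
  have hconst : ∀ j, hL.eigenvalues₀ j ≤ 0 → ∀ u w, e j u = e j w := by
    intro j hj u w
    have h1 : Matrix.toLinearMap₂' ℝ (G.lapMatrix ℝ) (e j) (e j) = 0 := by
      apply le_antisymm
      · rw [toLinearMap₂'_apply', he, dotProduct_smul, ho, if_pos rfl]
        simpa using hj
      · rw [SimpleGraph.lapMatrix_toLinearMap₂']
        positivity
    exact (G.lapMatrix_toLinearMap₂'_apply'_eq_zero_iff_forall_reachable (e j)).mp h1 u w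
      (hG.preconnected u w)
  have hj := (hL.eigenvalues₀_antitone
    (show (⟨i, hi'⟩ : Fin (Fintype.card V)) ≤ ⟨i + 1, hi⟩ by simp [Fin.le_def])).trans h
  obtain ⟨u⟩ := hG.nonempty
  have h1 := ho ⟨i, hi'⟩ ⟨i, hi'⟩
  have h2 := ho ⟨i + 1, hi⟩ ⟨i + 1, hi⟩
  have h3 := ho ⟨i, hi'⟩ ⟨i + 1, hi⟩
  simp only [dotProduct, fun w => hconst _ h w u, fun w => hconst _ hj w u, Finset.sum_const,
    nsmul_eq_mul, if_true] at h1 h2 h3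
  rw [if_neg (by simp)] at h3
  rcases mul_eq_zero.mp h3 with h3 | h3
  · rw [h3, zero_mul] at h1
    exact zero_ne_one h1
  · rcases mul_eq_zero.mp h3 with h3 | h3 <;> simp [h3] at h1 h2

/-! ### The spectral ratio of the path. -/

-- The cosine recurrence gives the interior equations. The shift by 1/2 makes the sequence symmetric
-- about the left end, and sin(nθ) = 0 does the same at the right end.
open Matrix in
theorem SimpleGraph.lapMatrix_pathGraph_mulVec_cos (n : ℕ)
    [DecidableRel (SimpleGraph.pathGraph n).Adj] {θ : ℝ} (hθ : Real.sin (n * θ) = 0) :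
    (SimpleGraph.pathGraph n).lapMatrix ℝ *ᵥ (fun j : Fin n => Real.cos ((j + 1 / 2) * θ)) =
      (2 - 2 * Real.cos θ) • (fun j : Fin n => Real.cos ((j + 1 / 2) * θ)) := by
  ext v
  set f : ℕ → ℝ := fun j => Real.cos ((j + 1 / 2) * θ) with hf
  have hrec : ∀ j : ℕ, f (j + 2) + f j = 2 * Real.cos θ * f (j + 1) := by
    intro j
    simp only [hf, Nat.cast_add, Nat.cast_ofNat, Nat.cast_one]
    rw [Real.cos_add_cos,
      show (((j : ℝ) + 2 + 1 / 2) * θ + (j + 1 / 2) * θ) / 2 = (j + 1 + 1 / 2) * θ by ring,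
      show (((j : ℝ) + 2 + 1 / 2) * θ - (j + 1 / 2) * θ) / 2 = θ by ring]
    ring
  have hzero : f 1 + f 0 = 2 * Real.cos θ * f 0 := by
    simp only [hf, Nat.cast_one, Nat.cast_zero]
    rw [Real.cos_add_cos, show ((1 + 1 / 2 : ℝ) * θ + (0 + 1 / 2) * θ) / 2 = θ by ring,
      show ((1 + 1 / 2 : ℝ) * θ - (0 + 1 / 2) * θ) / 2 = (0 + 1 / 2) * θ by ring]
  have hlast : ∀ j : ℕ, j + 1 = n → f (j + 1) = f j := by
    intro j hj
    rw [← sub_eq_zero]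
    simp only [hf]
    rw [Real.cos_sub_cos, show ((((j + 1 : ℕ) : ℝ) + 1 / 2) * θ + (j + 1 / 2) * θ) / 2
      = (n : ℝ) * θ by rw [← hj]; push_cast; ring, hθ]
    ring
  have hsum : ((SimpleGraph.pathGraph n).lapMatrix ℝ *ᵥ (fun j : Fin n => f j)) v =
      ∑ u : Fin n, ((if (v : ℕ) + 1 = u then f v - f u else 0) +
        (if (u : ℕ) + 1 = v then f v - f u else 0)) := by
    rw [SimpleGraph.lapMatrix_mulVec_apply, ← SimpleGraph.card_neighborFinset_eq_degree,
      ← nsmul_eq_mul, ← Finset.sum_const, ← Finset.sum_sub_distrib,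
      SimpleGraph.neighborFinset_eq_filter, Finset.sum_filter]
    refine Finset.sum_congr rfl fun u _ => ?_
    simp only [SimpleGraph.pathGraph_adj]
    split_ifs <;> first | omega | simp
  rw [hsum, Finset.sum_add_distrib,
    Fin.sum_univ_eq_sum_range (fun u => if (v : ℕ) + 1 = u then f v - f u else 0) n,
    Fin.sum_univ_eq_sum_range (fun u => if u + 1 = (v : ℕ) then f v - f u else 0) n,
    Finset.sum_ite_eq]
  have hv := v.2
  have h1 : (if (v : ℕ) + 1 ∈ Finset.range n then f v - f (v + 1) else 0) = f v - f (v + 1) := by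
    split_ifs with h
    · rfl
    · rw [hlast v (by rw [Finset.mem_range] at h; omega), sub_self]
  rw [h1]
  change _ = (2 - 2 * Real.cos θ) * f v
  rcases Nat.eq_zero_or_pos (v : ℕ) with h0 | h0
  · simp only [h0, Nat.succ_ne_zero, if_false, Finset.sum_const_zero, zero_add]
    linarith
  · obtain ⟨m, hm⟩ : ∃ m, (v : ℕ) = m + 1 := ⟨v - 1, by omega⟩
    simp only [hm, Nat.add_right_cancel_iff]
    rw [Finset.sum_ite_eq', if_pos (by simp; omega)]
    have := hrec m
    rw [show m + 1 + 1 = m + 2 from rfl]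
    linarith

theorem exists_lapEigenvalue_pathGraph_eq (n : ℕ) (hn : 1 ≤ n) {θ : ℝ}
    (hθ : Real.sin (n * θ) = 0) (h0 : 0 < θ) (hπ : θ < Real.pi) :
    ∃ i < n, lapEigenvalue (SimpleGraph.pathGraph n) i = 2 - 2 * Real.cos θ := by
  classical
  have h := exists_lapEigenvalue_eq (SimpleGraph.pathGraph n) (fun h => ?_)
    (SimpleGraph.lapMatrix_pathGraph_mulVec_cos n hθ)
  · simpa using h
  · have h1 := congrFun h ⟨0, hn⟩
    simp only [Nat.cast_zero, zero_add, Pi.zero_apply] at h1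
    exact (Real.cos_pos_of_mem_Ioo ⟨by linarith, by linarith⟩).ne' h1

/-- The left side tends to 4π² ≈ 39.48, so there is little room. With y = π/(2n) it is 4 sin²y (4n²
+ 5), and the Taylor bound for sin at y ≤ π/12 suffices. -/
theorem two_sub_two_mul_cos_pi_div_lt {n : ℕ} (hn : 6 ≤ n) :
    (2 - 2 * Real.cos (Real.pi / n)) * (4 * n ^ 2 + 5) < 40 := by
  have hn' : (6 : ℝ) ≤ n := by exact_mod_cast hn
  have hpi := Real.pi_lt_d4
  have hpi0 := Real.pi_pos
  set y : ℝ := Real.pi / (2 * n) with hy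
  have hy0 : 0 < y := by positivity
  have hyn : y * n = Real.pi / 2 := by rw [hy]; field_simp
  have hy1 : y ≤ 0.2619 := by
    have : y * 6 ≤ y * n := by gcongr
    linarith
  have hcos : 2 - 2 * Real.cos (Real.pi / n) = 4 * Real.sin y ^ 2 := by
    rw [show Real.pi / n = 2 * y by rw [hy]; field_simp, Real.cos_two_mul, Real.sin_sq]
    ring
  have hsin0 : 0 ≤ Real.sin y := Real.sin_nonneg_of_nonneg_of_le_pi hy0.le (by linarith [Real.pi_gt_three])
  have hsin : Real.sin y ≤ y * (1 - y ^ 2 / 6 + y ^ 4 / 100) := by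
    have h := Real.sin_bound (x := y) (by rw [abs_of_pos hy0]; linarith)
    rw [abs_of_pos hy0] at h
    have := (abs_le.mp h).2
    nlinarith
  set z : ℝ := y ^ 2 with hz
  have hz0 : 0 < z := by positivity
  have hz1 : z ≤ 0.0686 := by nlinarith
  have hzn : z * n ^ 2 < 2.46742 := by
    rw [hz, ← mul_pow, hyn]
    nlinarith
  have hsq : Real.sin y ^ 2 ≤ z * (1 - z / 3 + z ^ 2 / 20) := by
    calc Real.sin y ^ 2 ≤ (y * (1 - y ^ 2 / 6 + y ^ 4 / 100)) ^ 2 := by gcongr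
      _ = z * (1 - z / 6 + z ^ 2 / 100) ^ 2 := by rw [hz]; ring
      _ ≤ z * (1 - z / 3 + z ^ 2 / 20) := by
        gcongr
        nlinarith [mul_nonneg hz0.le (sq_nonneg z), sq_nonneg z,
          mul_nonneg (sq_nonneg z) (sub_nonneg.mpr hz1)]
  have hA : 0 < 1 - z / 3 + z ^ 2 / 20 := by nlinarith
  rw [hcos]
  calc 4 * Real.sin y ^ 2 * (4 * n ^ 2 + 5)
      ≤ 4 * (z * (1 - z / 3 + z ^ 2 / 20)) * (4 * n ^ 2 + 5) := by gcongr
    _ = (16 * (z * n ^ 2) + 20 * z) * (1 - z / 3 + z ^ 2 / 20) := by ring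
    _ ≤ (16 * 2.46742 + 20 * z) * (1 - z / 3 + z ^ 2 / 20) := by gcongr
    _ < 40 := by nlinarith [sq_nonneg z, mul_nonneg hz0.le (sq_nonneg z),
          mul_nonneg (sq_nonneg z) (sub_nonneg.mpr hz1), mul_nonneg hz0.le (sub_nonneg.mpr hz1)]

theorem lt_laplacianSpectralRatio_pathGraph {n : ℕ} (hn : 6 ≤ n) :
    (4 * (n : ℝ) ^ 2 - 5) / 10 < laplacianSpectralRatio (SimpleGraph.pathGraph n) := by
  have hn' : (6 : ℝ) ≤ n := by exact_mod_cast hn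
  have hpi0 := Real.pi_pos
  have hθ : Real.pi / n < Real.pi := div_lt_self hpi0 (by linarith)
  have hθ0 : 0 < Real.pi / n := by positivity
  obtain ⟨i, hi, hie⟩ := exists_lapEigenvalue_pathGraph_eq n (by omega)
    (θ := Real.pi - Real.pi / n)
    (by rw [show (n : ℝ) * (Real.pi - Real.pi / n) = ((n - 1 : ℤ) : ℝ) * Real.pi by
          push_cast; field_simp]
        exact Real.sin_int_mul_pi _) (by linarith) (by linarith)
  obtain ⟨j, hj, hje⟩ := exists_lapEigenvalue_pathGraph_eq n (by omega)
    (θ := Real.pi / n)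
    (by rw [mul_div_cancel₀ _ (by positivity)]; exact Real.sin_pi) hθ0 hθ
  rw [Real.cos_pi_sub] at hie
  set w := 2 - 2 * Real.cos (Real.pi / n) with hw
  have hw0 : 0 < w := by
    have : Real.cos (Real.pi / n) < 1 := by
      rw [← Real.cos_zero]
      exact Real.cos_lt_cos_of_nonneg_of_le_pi le_rfl hθ.le hθ0
    linarith
  have hw4 : w ≤ 4 := by linarith [Real.neg_one_le_cos (Real.pi / n)]
  have hcard : Fintype.card (Fin n) = n := Fintype.card_fin n
  have hlast := lapEigenvalue_last_nonpos (SimpleGraph.pathGraph n) (by omega)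
  rw [hcard] at hlast
  -- The eigenvalue `w` is positive, so it cannot sit at the last index.
  have hjn : j ≤ n - 2 := by
    by_contra h
    rw [show n - 1 = j by omega, hje] at hlast
    linarith
  have h2 : lapEigenvalue (SimpleGraph.pathGraph n) (n - 2) ≤ w :=
    (lapEigenvalue_anti _ hjn (by omega)).trans_eq hje
  have h1 : 4 - w ≤ lapEigenvalue (SimpleGraph.pathGraph n) 0 := by
    refine le_trans ?_ (lapEigenvalue_anti _ (Nat.zero_le i) (by omega))
    rw [hie]
    linarith
  have hconn : (SimpleGraph.pathGraph n).Connected := by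
    obtain ⟨m, rfl⟩ : ∃ m, n = m + 1 := ⟨n - 1, by omega⟩
    exact SimpleGraph.pathGraph_connected m
  have h3 : 0 < lapEigenvalue (SimpleGraph.pathGraph n) (n - 2) :=
    lapEigenvalue_pos_of_connected _ hconn (by omega)
  rw [laplacianSpectralRatio, hcard]
  calc (4 * (n : ℝ) ^ 2 - 5) / 10 < (4 - w) / w := by
        rw [lt_div_iff₀ hw0]
        have := two_sub_two_mul_cos_pi_div_lt hn
        rw [← hw] at this
        linarith
    _ ≤ _ := by gcongr; linarith

/-! ### Trees with a vertex of eccentricity at most two. -/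

open SimpleGraph in
/-- Two paths of length two between the same distinct vertices of an acyclic graph agree. -/
theorem SimpleGraph.IsAcyclic.eq_of_adj_adj {V : Type*} {T : SimpleGraph V} (hT : T.IsAcyclic)
    {a b c d : V} (hab : a ≠ b) (h1 : T.Adj a c) (h2 : T.Adj c b) (h3 : T.Adj a d)
    (h4 : T.Adj d b) : c = d := by
  have hp : (Walk.cons h1 (Walk.cons h2 Walk.nil)).IsPath := by
    simp [Walk.cons_isPath_iff, h2.ne, h1.ne, hab]
  have hq : (Walk.cons h3 (Walk.cons h4 Walk.nil)).IsPath := by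
    simp [Walk.cons_isPath_iff, h4.ne, h3.ne, hab]
  have h := congrArg Subtype.val ((hT.subsingleton_path _ _).elim ⟨_, hp⟩ ⟨_, hq⟩)
  simp only [Walk.cons.injEq] at h
  exact h.1

open SimpleGraph in
theorem SimpleGraph.IsAcyclic.not_adj_of_adj_adj {V : Type*} {T : SimpleGraph V} (hT : T.IsAcyclic)
    {a b c : V} (h1 : T.Adj a c) (h2 : T.Adj c b) : ¬ T.Adj a b := by
  intro h
  have hp : (Walk.cons h1 (Walk.cons h2 Walk.nil)).IsPath := by
    simp [Walk.cons_isPath_iff, h2.ne, h1.ne, h.ne]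
  have hq : (Walk.cons h Walk.nil).IsPath := by
    simp [Walk.cons_isPath_iff, h.ne]
  have h := congrArg (fun p => p.1.length) ((hT.subsingleton_path _ _).elim ⟨_, hp⟩ ⟨_, hq⟩)
  simp at h

/-- The vertex set is partitioned into `v`, its neighbours and the other neighbours of these, which
are leaves. -/
structure SimpleGraph.IsSpiderCenter {V : Type*} [Fintype V] [DecidableEq V] (T : SimpleGraph V)
    [DecidableRel T.Adj] (v : V) : Prop where
  sum_eq : ∀ F : V → ℝ, ∑ u, F u = F v + ∑ c ∈ T.neighborFinset v,
    (F c + ∑ g ∈ (T.neighborFinset c).erase v, F g)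
  neighborFinset_leaf : ∀ c ∈ T.neighborFinset v, ∀ g ∈ (T.neighborFinset c).erase v,
    T.neighborFinset g = {c}

-- Adjacent vertices of a tree have different distances from `v`, so a vertex at distance two has
-- neighbours only at distance one, and by uniqueness of paths only one.
open SimpleGraph in
theorem SimpleGraph.IsTree.isSpiderCenter {V : Type*} [Fintype V] [DecidableEq V]
    {T : SimpleGraph V} [DecidableRel T.Adj] (hT : T.IsTree) {v : V} (hv : ∀ x, T.dist x v < 3) :
    T.IsSpiderCenter v := by
  have hac := hT.isAcyclic
  have hclass : ∀ u, u ≠ v → ¬ T.Adj v u → ∃ c, T.Adj v c ∧ T.Adj c u := by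
    intro u huv hadj
    obtain ⟨p, hp⟩ := (hT.connected v u).exists_walk_length_eq_dist
    have hd := hv u
    rw [dist_comm, ← hp] at hd
    match p, hd with
    | .nil, _ => exact absurd rfl huv
    | .cons h .nil, _ => exact absurd h hadj
    | .cons h (.cons h' .nil), _ => exact ⟨_, h, h'⟩
    | .cons h (.cons h' (.cons h'' q)), hd => simp at hd; omega
  have hleaf : ∀ c ∈ T.neighborFinset v, ∀ g ∈ (T.neighborFinset c).erase v,
      T.neighborFinset g = {c} := by
    intro c hc g hg
    simp only [Finset.mem_erase, mem_neighborFinset] at hc hg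
    have hvg : ¬ T.Adj v g := hac.not_adj_of_adj_adj hc hg.2
    ext h
    simp only [mem_neighborFinset, Finset.mem_singleton]
    constructor
    · intro hgh
      by_cases hhv : h = v
      · subst hhv
        exact absurd hgh.symm hvg
      by_cases hvh : T.Adj v h
      · exact (hac.eq_of_adj_adj hg.1.symm hc hg.2 hvh hgh.symm).symm
      · obtain ⟨d, hvd, hdh⟩ := hclass h hhv hvh
        exfalso
        -- `g` and `h` are adjacent at the same distance from `v`
        have hdg : T.dist v g = 2 := by
          have h1 := dist_le (Walk.cons hc (Walk.cons hg.2 Walk.nil))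
          simp only [Walk.length_cons, Walk.length_nil] at h1
          have h2 : T.dist v g ≠ 0 := by
            rw [Ne, (hT.connected v g).dist_eq_zero_iff]
            exact hg.1.symm
          have h3 : T.dist v g ≠ 1 := by rwa [Ne, dist_eq_one_iff_adj]
          omega
        have hdh2 : T.dist v h = 2 := by
          have h1 := dist_le (Walk.cons hvd (Walk.cons hdh Walk.nil))
          simp only [Walk.length_cons, Walk.length_nil] at h1
          have h2 : T.dist v h ≠ 0 := by
            rw [Ne, (hT.connected v h).dist_eq_zero_iff]
            exact fun h' => hhv h'.symm
          have h3 : T.dist v h ≠ 1 := by rwa [Ne, dist_eq_one_iff_adj]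
          omega
        exact hT.dist_ne_of_adj v hgh (hdg.trans hdh2.symm)
    · rintro rfl
      exact hg.2.symm
  refine ⟨fun F => ?_, hleaf⟩
  have huniv : (Finset.univ : Finset V) = insert v (T.neighborFinset v ∪
      (T.neighborFinset v).biUnion fun c => (T.neighborFinset c).erase v) := by
    ext u
    simp only [Finset.mem_univ, Finset.mem_insert, Finset.mem_union, Finset.mem_biUnion,
      Finset.mem_erase, mem_neighborFinset, true_iff]
    by_cases h1 : u = v
    · exact Or.inl h1
    by_cases h2 : T.Adj v u
    · exact Or.inr (Or.inl h2)
    obtain ⟨c, hc1, hc2⟩ := hclass u h1 h2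
    exact Or.inr (Or.inr ⟨c, hc1, h1, hc2⟩)
  rw [huniv, Finset.sum_insert (by simp), Finset.sum_union, Finset.sum_biUnion,
    Finset.sum_add_distrib]
  -- A leaf determines the neighbour of `v` that it hangs from.
  · intro c hc d hd hcd
    rw [Function.onFun, Finset.disjoint_left]
    intro g hg hg'
    have h1 := hleaf c hc g hg
    rw [hleaf d hd g hg', Finset.singleton_inj] at h1
    exact hcd h1.symm
  · rw [Finset.disjoint_left]
    intro u hu hu'
    simp only [Finset.mem_biUnion, Finset.mem_erase, mem_neighborFinset] at hu hu'
    obtain ⟨c, hc, -, hcu⟩ := hu'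
    exact hac.not_adj_of_adj_adj hc hcu hu

/-- The number of leaves hanging from the neighbour `c` of the center `v`. -/
def SimpleGraph.numLeaves {V : Type*} [Fintype V] [DecidableEq V] (T : SimpleGraph V)
    [DecidableRel T.Adj] (v c : V) : ℕ := ((T.neighborFinset c).erase v).card

/-! ### The Laplacian form and the upper bound for the largest eigenvalue. -/

namespace SimpleGraph.IsSpiderCenter

variable {V : Type*} [Fintype V] [DecidableEq V] {T : SimpleGraph V} [DecidableRel T.Adj] {v : V}

theorem card_eq (h : T.IsSpiderCenter v) :
    Fintype.card V = 1 + T.degree v + ∑ c ∈ T.neighborFinset v, T.numLeaves v c := by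
  have := h.sum_eq (fun _ => 1)
  simp only [Finset.sum_const, nsmul_eq_mul, mul_one, Finset.card_univ,
    Finset.sum_add_distrib] at this
  rw [← @Nat.cast_inj ℝ]
  push_cast
  rw [this, SimpleGraph.card_neighborFinset_eq_degree, add_assoc]
  rfl

theorem form_eq (h : T.IsSpiderCenter v) (x : V → ℝ) :
    (∑ i, ∑ j ∈ T.neighborFinset i, (x i - x j) ^ 2) / 2 =
      ∑ c ∈ T.neighborFinset v, ((x c - x v) ^ 2 +
        ∑ g ∈ (T.neighborFinset c).erase v, (x g - x c) ^ 2) := by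
  rw [h.sum_eq]
  have h1 : ∀ c ∈ T.neighborFinset v,
      (∑ j ∈ T.neighborFinset c, (x c - x j) ^ 2 + ∑ g ∈ (T.neighborFinset c).erase v,
        ∑ j ∈ T.neighborFinset g, (x g - x j) ^ 2) =
      (x c - x v) ^ 2 + 2 * ∑ g ∈ (T.neighborFinset c).erase v, (x g - x c) ^ 2 := by
    intro c hc
    rw [← Finset.add_sum_erase _ _ (show v ∈ T.neighborFinset c by
      simpa [SimpleGraph.adj_comm] using hc), add_assoc, two_mul]
    congr 2
    · exact Finset.sum_congr rfl fun g _ => by ring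
    · refine Finset.sum_congr rfl fun g hg => ?_
      rw [h.neighborFinset_leaf c hc g hg, Finset.sum_singleton]
  rw [Finset.sum_congr rfl h1, Finset.sum_add_distrib, Finset.sum_add_distrib, ← Finset.mul_sum,
    Finset.sum_congr rfl (fun c _ => show (x v - x c) ^ 2 = (x c - x v) ^ 2 by ring)]
  ring

/-- Weighting the edges by degrees bounds the Laplacian form. -/
theorem form_le (h : T.IsSpiderCenter v) {U : ℝ} (hk : 1 ≤ T.degree v)
    (hroot : (T.degree v : ℝ) + (Fintype.card V - 1) / T.degree v ≤ U)
    (hmid : ∀ c ∈ T.neighborFinset v, (T.numLeaves v c : ℝ) + 2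
      + (T.degree v - 1) / (T.numLeaves v c + 1) ≤ U) (x : V → ℝ) :
    (∑ i, ∑ j ∈ T.neighborFinset i, (x i - x j) ^ 2) / 2 ≤ U * ∑ i, x i ^ 2 := by
  rw [h.form_eq, h.sum_eq]
  set k : ℝ := (T.degree v : ℝ) with hk_def
  have hk1 : (1 : ℝ) ≤ k := by rw [hk_def]; exact_mod_cast hk
  have hk0 : 0 < k := by linarith
  have amgm : ∀ a b w : ℝ, 0 < w → (a - b) ^ 2 ≤ (1 + w) * a ^ 2 + (1 + 1 / w) * b ^ 2 := by
    intro a b w hw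
    have : (1 + w) * a ^ 2 + (1 + 1 / w) * b ^ 2 - (a - b) ^ 2 = (w * a + b) ^ 2 / w := by
      field_simp
      ring
    have h2 : 0 ≤ (w * a + b) ^ 2 / w := by positivity
    linarith
  have hbranch : ∀ c ∈ T.neighborFinset v, (x c - x v) ^ 2 +
        ∑ g ∈ (T.neighborFinset c).erase v, (x g - x c) ^ 2 ≤
      (1 + (T.numLeaves v c + 1 : ℝ) / k) * x v ^ 2 +
        U * (x c ^ 2 + ∑ g ∈ (T.neighborFinset c).erase v, x g ^ 2) := by
    intro c hc
    set m : ℝ := (T.numLeaves v c : ℝ) with hm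
    have hm0 : 0 ≤ m := by positivity
    -- Here and at the leaves the weight is the quotient of the end degrees. Each vertex then
    -- collects its degree plus the average degree of its neighbours.
    have h1 := amgm (x c) (x v) (k / (m + 1)) (by positivity)
    have h2 : ∑ g ∈ (T.neighborFinset c).erase v, (x g - x c) ^ 2 ≤
        ∑ g ∈ (T.neighborFinset c).erase v,
          (U * x g ^ 2 + (1 + 1 / (1 + m)) * x c ^ 2) := by
      refine Finset.sum_le_sum fun g _ => (amgm (x g) (x c) (1 + m) (by positivity)).trans ?_
      gcongr
      have : 0 ≤ (k - 1) / (m + 1) := div_nonneg (by linarith) (by linarith)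
      linarith [hmid c hc]
    rw [Finset.sum_add_distrib, ← Finset.mul_sum, Finset.sum_const, nsmul_eq_mul] at h2
    change _ ≤ _ + m * _ at h2
    have h3 : (1 + k / (m + 1)) * x c ^ 2 + m * ((1 + 1 / (1 + m)) * x c ^ 2) ≤ U * x c ^ 2 := by
      rw [← mul_assoc, ← add_mul]
      refine mul_le_mul_of_nonneg_right ((Eq.le ?_).trans (hmid c hc)) (sq_nonneg _)
      rw [← hm]
      field_simp
      ring
    have h4 : 1 + 1 / (k / (m + 1)) = 1 + (m + 1) / k := by rw [one_div_div]
    rw [h4] at h1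
    linarith
  refine (Finset.sum_le_sum hbranch).trans ?_
  rw [Finset.sum_add_distrib, ← Finset.sum_mul, ← Finset.mul_sum, mul_add]
  gcongr
  refine (Eq.le ?_).trans hroot
  rw [Finset.sum_add_distrib, ← Finset.sum_div, Finset.sum_add_distrib, h.card_eq]
  simp only [Finset.sum_const, nsmul_eq_mul, mul_one, SimpleGraph.card_neighborFinset_eq_degree]
  push_cast
  ring

end SimpleGraph.IsSpiderCenter

/-! ### Lower bounds for the second smallest eigenvalue. -/

namespace SimpleGraph.IsSpiderCenter

variable {V : Type*} [Fintype V] [DecidableEq V] {T : SimpleGraph V} [DecidableRel T.Adj] {v : V}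

/-- Completing the square at the leaves of a branch. -/
theorem branch_ge {lam : ℝ} (h1 : lam < 1) (c : V) (x : V → ℝ) :
    (1 - lam - T.numLeaves v c * (lam / (1 - lam))) * x c ^ 2 - 2 * x c * x v + x v ^ 2 +
      lam * (x c ^ 2 + ∑ g ∈ (T.neighborFinset c).erase v, x g ^ 2) ≤
    (x c - x v) ^ 2 + ∑ g ∈ (T.neighborFinset c).erase v, (x g - x c) ^ 2 := by
  have hne : 0 < 1 - lam := by linarith
  have hg : ∀ g ∈ (T.neighborFinset c).erase v,
      lam * x g ^ 2 - lam / (1 - lam) * x c ^ 2 ≤ (x g - x c) ^ 2 := by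
    intro g _
    have : (x g - x c) ^ 2 - (lam * x g ^ 2 - lam / (1 - lam) * x c ^ 2) =
        ((1 - lam) * x g - x c) ^ 2 / (1 - lam) := by
      field_simp
      ring
    have h2 : 0 ≤ ((1 - lam) * x g - x c) ^ 2 / (1 - lam) := by positivity
    linarith
  have := Finset.sum_le_sum hg
  rw [Finset.sum_sub_distrib, ← Finset.mul_sum, Finset.sum_const, nsmul_eq_mul] at this
  change _ - (T.numLeaves v c : ℝ) * _ ≤ _ at this
  linarith

/-- On the hyperplane x_v = 0 the branches decouple. -/
theorem le_lapEigenvalue_of_numLeaves_le (h : T.IsSpiderCenter v) {lam : ℝ} (h1 : lam < 1)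
    (hm : ∀ c ∈ T.neighborFinset v, T.numLeaves v c * (lam / (1 - lam)) ≤ 1 - lam)
    {i : ℕ} (hi : i + 1 < Fintype.card V) : lam ≤ lapEigenvalue T i := by
  refine le_lapEigenvalue T (LinearMap.proj v) (fun x hx => ?_) hi
  rw [LinearMap.proj_apply] at hx
  rw [h.form_eq, h.sum_eq, hx, mul_add, Finset.mul_sum, zero_pow two_ne_zero, mul_zero, zero_add]
  refine Finset.sum_le_sum fun c hc => ?_
  have := branch_ge (T := T) (v := v) h1 c x
  rw [hx] at this
  have h2 := mul_nonneg (sub_nonneg.mpr (hm c hc)) (sq_nonneg (x c))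
  linarith

/-- Let b_c be the coefficient of x_c² in `branch_ge`. On the hyperplane b_d x_d = x_v the branch at
`d` contributes exactly (1 - 1/b_d) x_v², whatever the sign of b_d; the other branches contribute at
least this by completing the square, and `hsum` adds everything up. -/
theorem le_lapEigenvalue_of_sum_le (h : T.IsSpiderCenter v) {lam : ℝ} (h1 : lam < 1)
    {d : V} (hd : d ∈ T.neighborFinset v)
    (hd0 : 1 - lam - T.numLeaves v d * (lam / (1 - lam)) ≠ 0)
    (hpos : ∀ c ∈ (T.neighborFinset v).erase d,
      0 < 1 - lam - T.numLeaves v c * (lam / (1 - lam)))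
    (hsum : ∑ c ∈ T.neighborFinset v, 1 / (1 - lam - T.numLeaves v c * (lam / (1 - lam))) ≤
      T.degree v - lam)
    {i : ℕ} (hi : i + 1 < Fintype.card V) : lam ≤ lapEigenvalue T i := by
  set b : V → ℝ := fun c => 1 - lam - T.numLeaves v c * (lam / (1 - lam)) with hb
  refine le_lapEigenvalue T (b d • LinearMap.proj d - LinearMap.proj v) (fun x hx => ?_) hi
  simp only [LinearMap.sub_apply, LinearMap.smul_apply, LinearMap.proj_apply, smul_eq_mul] at hx
  have hq : ∀ c ∈ T.neighborFinset v,
      x v ^ 2 - (1 / b c) * x v ^ 2 ≤ b c * x c ^ 2 - 2 * x c * x v + x v ^ 2 := by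
    intro c hc
    by_cases hcd : c = d
    · subst hcd
      refine Eq.le ?_
      rw [show x v = b c * x c by linarith]
      field_simp
      ring
    · have hbc : 0 < b c := hpos c (Finset.mem_erase.mpr ⟨hcd, hc⟩)
      have h3 : b c * x c ^ 2 - 2 * x c * x v + x v ^ 2 - (x v ^ 2 - (1 / b c) * x v ^ 2) =
          (b c * x c - x v) ^ 2 / b c := by
        field_simp
        ring
      have h4 : 0 ≤ (b c * x c - x v) ^ 2 / b c := by positivity
      linarith
  rw [h.form_eq, h.sum_eq, mul_add, Finset.mul_sum]
  have h5 := Finset.sum_le_sum fun c hc =>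
    (add_le_add_left (hq c hc) _).trans (branch_ge (T := T) (v := v) h1 c x)
  rw [Finset.sum_add_distrib, Finset.sum_sub_distrib, ← Finset.sum_mul, Finset.sum_const,
    nsmul_eq_mul, SimpleGraph.card_neighborFinset_eq_degree] at h5
  have h6 := mul_le_mul_of_nonneg_right hsum (sq_nonneg (x v))
  change (∑ c ∈ T.neighborFinset v, 1 / b c) * _ ≤ _ at h6
  linarith

/-- Convexity: a sum of terms `1 / (a - m c)` is largest when all the mass is in one term. -/
theorem _root_.Finset.sum_one_div_sub_le {ι : Type*} (s : Finset ι) (m : ι → ℝ) {a : ℝ}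
    (hm : ∀ c ∈ s, 0 ≤ m c) (ha : ∑ c ∈ s, m c < a) :
    ∑ c ∈ s, 1 / (a - m c) ≤ (s.card - 1) / a + 1 / (a - ∑ c ∈ s, m c) := by
  set R := ∑ c ∈ s, m c with hR
  have hR0 : 0 ≤ R := Finset.sum_nonneg hm
  have ha0 : 0 < a := by linarith
  have haR : 0 < a - R := by linarith
  -- The right side is the chord of 1/(a - m) between m = 0 and m = R.
  have hterm : ∀ c ∈ s, 1 / (a - m c) ≤ 1 / a + m c * (1 / (a * (a - R))) := by
    intro c hc
    have hmc : m c ≤ R := Finset.single_le_sum hm hc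
    have hamc : 0 < a - m c := by linarith
    have e : 1 / (a - m c) = 1 / a + m c * (1 / (a * (a - m c))) := by
      field_simp
      ring
    rw [e]
    have := hm c hc
    gcongr
  refine (Finset.sum_le_sum hterm).trans (Eq.le ?_)
  rw [Finset.sum_add_distrib, ← Finset.sum_mul, ← hR, Finset.sum_const, nsmul_eq_mul]
  field_simp
  ring

end SimpleGraph.IsSpiderCenter

/-! ### The arithmetic inequalities. -/

/-- The arithmetic conditions, on the degree `k` of the center, the largest number `M` of leaves at
a neighbour and the number `n - 1 - k - M` of the other leaves, under which `U` and `L` bound the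
spectrum, for small `n`. -/
theorem exists_spectral_bounds_of_le : ∀ n ∈ Finset.Icc 6 15, ∀ k ∈ Finset.Icc 1 (n - 1),
    ∀ M ∈ Finset.range (n - k), n - 1 - k - M ≤ (k - 1) * M →
    let U : ℚ := max ((k : ℚ) + (n - 1) / k) (M + 2 + (k - 1) / (M + 1))
    let L : ℚ := U / ((4 * n ^ 2 - 5) / 10)
    let r : ℕ := n - 1 - k - M
    L < 1 ∧ ((M : ℚ) * (L / (1 - L)) ≤ 1 - L ∨
      1 - L < M * (L / (1 - L)) ∧ (r : ℚ) * (L / (1 - L)) < 1 - L ∧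
      1 / (1 - L - M * (L / (1 - L))) + ((k - 2) / (1 - L) + 1 / (1 - L - r * (L / (1 - L)))) ≤
        k - L) := by
  decide +kernel

theorem mul_div_one_sub_le {M L : ℝ} (hL : 0 < L) (hM : 0 ≤ M) (h : L * (M + 2) ≤ 1) :
    L < 1 ∧ M * (L / (1 - L)) ≤ 1 - L := by
  have h1 : L < 1 := by nlinarith
  refine ⟨h1, ?_⟩
  rw [← mul_div_assoc, div_le_iff₀ (by linarith)]
  nlinarith

/-- Used with s = 1/L, q = M + 2, N = n + 1. `X` is the coefficient of the heaviest branch and `Y`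
that of one branch absorbing the others; 2 - 1/s is what k - L leaves after k - 2 unit terms. -/
theorem one_div_add_one_div_le {s q N X Y : ℝ} (hs : 1 < s) (hqs : s < q) (hN : N < s + q)
    (hNs : 2 * q * (N - q) ≤ N * s) (hX : X < 0) (hX' : -X ≤ (q - s) / (s - 1))
    (hY : (s + q - N) / (s - 1) ≤ Y) : 1 / X + 1 / Y ≤ 2 - 1 / s := by
  have hs1 : 0 < s - 1 := by linarith
  have hA : 0 < q - s := by linarith
  have hB : 0 < s + q - N := by linarith
  have h1 : 1 / X ≤ -((s - 1) / (q - s)) := by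
    have : 1 / ((q - s) / (s - 1)) ≤ 1 / (-X) := one_div_le_one_div_of_le (by linarith) hX'
    rw [one_div_div, one_div_neg_eq_neg_one_div] at this
    linarith
  have h2 : 1 / Y ≤ (s - 1) / (s + q - N) := by
    have : 1 / Y ≤ 1 / ((s + q - N) / (s - 1)) := one_div_le_one_div_of_le (by positivity) hY
    rwa [one_div_div] at this
  have h3 : (2 - 1 / s) - (-((s - 1) / (q - s)) + (s - 1) / (s + q - N)) =
      ((2 * s - 1) * ((q - s) * (s + q - N)) - s * (s - 1) * (N - 2 * s)) /
        (s * ((q - s) * (s + q - N))) := by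
    field_simp
    ring
  -- This is `hNs` rearranged.
  have h4 : s * (N - 2 * s) ≤ 2 * ((q - s) * (s + q - N)) := by nlinarith
  have h5 : 0 ≤ (2 * s - 1) * ((q - s) * (s + q - N)) - s * (s - 1) * (N - 2 * s) := by
    have hAB : 0 < (q - s) * (s + q - N) := by positivity
    nlinarith
  have h6 : 0 ≤ ((2 * s - 1) * ((q - s) * (s + q - N)) - s * (s - 1) * (N - 2 * s)) /
        (s * ((q - s) * (s + q - N))) := by positivity
  linarith

/-- Moving `d` unit terms into the mass `r` of the last term. -/
theorem div_one_sub_add_le {L r d : ℝ} (hL : 0 < L) (hL1 : L < 1) (hr : 0 ≤ r) (hd : 0 ≤ d)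
    (hY : 0 < 1 - L - (r + d) * (L / (1 - L))) :
    d / (1 - L) + 1 / (1 - L - r * (L / (1 - L))) ≤
      d + 1 / (1 - L - (r + d) * (L / (1 - L))) := by
  have h1 : 0 < 1 - L := by linarith
  set t := L / (1 - L) with ht
  have ht0 : 0 < t := by positivity
  have hrt : 0 ≤ r * t := by positivity
  have hdt : 0 ≤ d * t := by positivity
  have hZ : 0 < 1 - L - r * t := by linarith
  have e1 : d / (1 - L) = d + d * t := by
    rw [ht]
    field_simp
    ring
  have e2 : 1 / (1 - L - (r + d) * t) = 1 / (1 - L - r * t) +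
      d * t / ((1 - L - r * t) * (1 - L - (r + d) * t)) := by
    field_simp
    ring
  have h3 : d * t ≤ d * t / ((1 - L - r * t) * (1 - L - (r + d) * t)) := by
    rw [le_div_iff₀ (by positivity)]
    have : (1 - L - r * t) * (1 - L - (r + d) * t) ≤ 1 :=
      mul_le_one₀ (by linarith) hY.le (by linarith)
    nlinarith
  rw [e1, e2]
  linarith

/-- Both cases give (n+3)²/4. For k ≤ (n-1)/2, convexity in k bounds the first factor by its value
(n+3)/2 at k = 2 and k = (n-1)/2; for larger k the factors are at most k + 2 and n + 1 - k, with sum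
n + 3. -/
theorem mul_le_of_root_bound {n k M : ℝ} (hn : 12 ≤ n) (hk : 2 ≤ k) (hM : 0 ≤ M)
    (hkM : k + M + 1 ≤ n) (h : M + 2 ≤ k + (n - 1) / k) :
    (k + (n - 1) / k) * (M + 2) ≤ (4 * n ^ 2 - 5) / 10 := by
  have hn3 : (n + 3) ^ 2 / 4 ≤ (4 * n ^ 2 - 5) / 10 := by nlinarith
  refine le_trans ?_ hn3
  have hk0 : 0 < k := by linarith
  have hU0 : 0 ≤ k + (n - 1) / k := by
    have : 0 ≤ (n - 1) / k := div_nonneg (by linarith) hk0.le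
    linarith
  rcases le_total k ((n - 1) / 2) with hkn | hkn
  · have h1 : k + (n - 1) / k ≤ (n + 3) / 2 := by
      rw [← le_sub_iff_add_le', div_le_iff₀ hk0]
      nlinarith
    nlinarith
  · have h1 : (n - 1) / k ≤ 2 := by
      rw [div_le_iff₀ hk0]
      linarith
    have h2 : (k + (n - 1) / k) * (M + 2) ≤ (k + 2) * (n + 1 - k) := by
      apply mul_le_mul <;> linarith
    nlinarith [sq_nonneg (2 * k + 1 - n)]

theorem two_mul_mul_le_of_sixteen_le {n q : ℝ} (hn : 16 ≤ n) (hq : 3 * n / 5 ≤ q)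
    (hqn : q ≤ n + 1) :
    2 * q * (n + 1 - q) * (q + 3 / 4) ≤ (n + 1) * ((4 * n ^ 2 - 5) / 10) := by
  -- The cubic is maximal at q = 2(n+1)/3.
  have hcube : 27 * (q ^ 2 * (n + 1 - q)) ≤ 4 * (n + 1) ^ 3 := by
    have h1 : 0 ≤ (2 * (n + 1) - 3 * q) ^ 2 * (3 * q + (n + 1)) :=
      mul_nonneg (sq_nonneg _) (by linarith)
    have h2 : (2 * (n + 1) - 3 * q) ^ 2 * (3 * q + (n + 1)) =
        4 * (n + 1) ^ 3 - 27 * (q ^ 2 * (n + 1 - q)) := by ring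
    linarith
  -- Since q ≥ 9.6 when n ≥ 16, 3/4 is at most 0.08 q.
  have h4 : 2 * q * (n + 1 - q) * (q + 3 / 4) ≤ 2 * q * (n + 1 - q) * (1.08 * q) := by
    refine mul_le_mul_of_nonneg_left (by linarith) (mul_nonneg ?_ ?_) <;> linarith
  have h5 : 2.16 * (4 / 27 * (n + 1) ^ 2) ≤ (4 * n ^ 2 - 5) / 10 := by nlinarith
  have h6 := mul_le_mul_of_nonneg_left h5 (by linarith : 0 ≤ n + 1)
  have h7 : (n + 1) * (2.16 * (4 / 27 * (n + 1) ^ 2)) = 2.16 / 27 * (4 * (n + 1) ^ 3) := by ring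
  have h8 : 2 * q * (n + 1 - q) * (1.08 * q) = 2.16 * (q ^ 2 * (n + 1 - q)) := by ring
  linarith

theorem scale_bounds {n q U s : ℝ} (hn : 16 ≤ n) (hq3 : 3 ≤ q) (hqn : q ≤ n - 1) (hU0 : 0 < U)
    (hU2 : U ≤ q + (n - q) / (q - 1)) (hs0 : 0 < s) (hsq : s < q)
    (hUs : U * s = (4 * n ^ 2 - 5) / 10) :
    2 * q * (n + 1 - q) ≤ (n + 1) * s ∧ n + 1 < s + q := by
  have hqU : ((4 * n ^ 2 - 5) / 10) < q * U := by rw [← hUs, mul_comm]; gcongr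
  -- As s < q, ρ = Us is less than qU, which is too small unless q is a large part of n.
  have hq6 : 3 * n / 5 ≤ q := by
    by_contra! hc
    have h2 : (n - q) / (q - 1) * q ≤ 3 / 2 * (n - q) := by
      rw [div_mul_eq_mul_div, div_le_iff₀ (by linarith)]
      nlinarith
    have h3 : ((4 * n ^ 2 - 5) / 10) < q ^ 2 + 3 / 2 * (n - q) := by nlinarith
    nlinarith
  have hU3 : U ≤ q + 3 / 4 := by
    have : (n - q) / (q - 1) ≤ 3 / 4 := by
      rw [div_le_iff₀ (by linarith)]
      linarith
    linarith
  have hUs2 : ((4 * n ^ 2 - 5) / 10) ≤ (q + 3 / 4) * s := by rw [← hUs]; gcongr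
  have hNs : 2 * q * (n + 1 - q) ≤ (n + 1) * s := by
    have h2 : 2 * q * (n + 1 - q) * (q + 3 / 4) ≤ (n + 1) * ((4 * n ^ 2 - 5) / 10) :=
      two_mul_mul_le_of_sixteen_le hn hq6 (by linarith)
    have h7 : 2 * q * (n + 1 - q) * (q + 3 / 4) ≤ (n + 1) * s * (q + 3 / 4) := by
      refine h2.trans ?_
      rw [mul_assoc, mul_comm s]
      gcongr
    exact le_of_mul_le_mul_right h7 (by linarith)
  have hNq : n + 1 < s + q := by
    by_contra! hc
    have h2 : (q + 3 / 4) * s ≤ (q + 3 / 4) * (n + 1 - q) := by gcongr; linarith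
    have h3 : (q + 3 / 4) * (n + 1 - q) ≤ (n + 7 / 4) ^ 2 / 4 := by
      nlinarith [sq_nonneg (2 * q - n - 1 / 4)]
    have h4 : (n + 7 / 4) ^ 2 / 4 < ((4 * n ^ 2 - 5) / 10) := by nlinarith
    linarith
  exact ⟨hNs, hNq⟩

theorem spectral_bounds_of_branch_bound {n k M r : ℝ} (hn : 16 ≤ n) (hk : 2 ≤ k) (hM : 1 ≤ M)
    (hr : 0 ≤ r) (hsum : n = 1 + k + M + r) {U L : ℝ} (hU : U = M + 2 + (k - 1) / (M + 1))
    (hUL : U = L * ((4 * n ^ 2 - 5) / 10)) (hL : 0 < L) (hL1 : L < 1)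
    (hA : 1 - L < M * (L / (1 - L))) :
    r * (L / (1 - L)) < 1 - L ∧
      1 / (1 - L - M * (L / (1 - L))) + ((k - 2) / (1 - L) + 1 / (1 - L - r * (L / (1 - L)))) ≤
        k - L := by
  set ρ := (4 * n ^ 2 - 5) / 10 with hρ
  set q := M + 2 with hq
  have h1L : 0 < 1 - L := by linarith
  have hρ0 : 0 < ρ := by rw [hρ]; nlinarith
  set s := 1 / L with hs
  have hLs : L = 1 / s := by rw [hs, one_div_one_div]
  have hs1 : 1 < s := by rw [hs, lt_div_iff₀ hL]; linarith
  have hs0 : 0 < s := by linarith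
  have hUs : U * s = ρ := by rw [hUL, hs]; field_simp
  have ht : L / (1 - L) = 1 / (s - 1) := by
    rw [hLs]
    have : s - 1 ≠ 0 := by linarith
    field_simp
  have hsq : s < q := by
    rw [← mul_div_assoc, lt_div_iff₀ h1L] at hA
    have : L * s = 1 := by rw [hs]; field_simp
    have hM2 : 1 < L * q := by rw [hq]; nlinarith
    by_contra! hc
    nlinarith
  have hU0 : 0 < U := by rw [hUL]; positivity
  have hkq : k - 1 ≤ n - q := by linarith
  have hU2 : U ≤ q + (n - q) / (q - 1) := by
    rw [hU, show M + 1 = q - 1 by rw [hq]; ring]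
    gcongr
    linarith
  have hq3 : 3 ≤ q := by linarith
  have hqn : q ≤ n - 1 := by linarith
  obtain ⟨hNs, hNq⟩ := scale_bounds hn hq3 hqn hU0 hU2 hs0 hsq hUs
  have hs1' : 0 < s - 1 := by linarith
  have hX' : -(1 - L - M * (L / (1 - L))) ≤ (q - s) / (s - 1) := by
    rw [ht, hLs]
    have e : (q - s) / (s - 1) - -(1 - 1 / s - M * (1 / (s - 1))) = 1 / (s * (s - 1)) := by
      rw [hq]
      field_simp
      ring
    have : 0 < 1 / (s * (s - 1)) := by positivity
    linarith
  -- The k - 2 unit terms are merged into the mass `r`, and r + k - 2 = n - 1 - q.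
  have hY : (s + q - (n + 1)) / (s - 1) ≤ 1 - L - (r + (k - 2)) * (L / (1 - L)) := by
    rw [ht, hLs]
    have e : 1 - 1 / s - (r + (k - 2)) * (1 / (s - 1)) - (s + q - (n + 1)) / (s - 1) =
        1 / (s * (s - 1)) := by
      rw [hq, hsum]
      field_simp
      ring
    have : 0 < 1 / (s * (s - 1)) := by positivity
    linarith
  have hY0 : 0 < 1 - L - (r + (k - 2)) * (L / (1 - L)) :=
    lt_of_lt_of_le (div_pos (by linarith) hs1') hY
  have hkt : 0 ≤ (k - 2) * (L / (1 - L)) := mul_nonneg (by linarith) (by positivity)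
  refine ⟨by linarith, ?_⟩
  have h8 := one_div_add_one_div_le hs1 hsq hNq hNs (by linarith) hX' hY
  have h9 := div_one_sub_add_le hL hL1 hr (by linarith : 0 ≤ k - 2) hY0
  rw [← hLs] at h8
  linarith

theorem exists_spectral_bounds {n k M r : ℕ} (hn : 6 ≤ n) (hk : 1 ≤ k) (hsum : n = 1 + k + M + r)
    (hr : r ≤ (k - 1) * M) : ∃ U L : ℝ,
      (k : ℝ) + (n - 1) / k ≤ U ∧ (M : ℝ) + 2 + (k - 1) / (M + 1) ≤ U ∧
      U = L * ((4 * n ^ 2 - 5) / 10) ∧ 0 < L ∧ L < 1 ∧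
      ((M : ℝ) * (L / (1 - L)) ≤ 1 - L ∨
        1 - L < M * (L / (1 - L)) ∧ (r : ℝ) * (L / (1 - L)) < 1 - L ∧
        1 / (1 - L - M * (L / (1 - L))) +
          ((k - 2) / (1 - L) + 1 / (1 - L - r * (L / (1 - L)))) ≤ k - L) := by
  have hnR : (6 : ℝ) ≤ n := by exact_mod_cast hn
  have hkR : (1 : ℝ) ≤ k := by exact_mod_cast hk
  have hρ : 0 < (4 * (n : ℝ) ^ 2 - 5) / 10 := by nlinarith
  have hUa0 : 0 < (k : ℝ) + (n - 1) / k := by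
    have : 0 ≤ ((n : ℝ) - 1) / k := div_nonneg (by linarith) (by linarith)
    linarith
  rcases Nat.lt_or_ge n 16 with hn16 | hn16
  · have h := exists_spectral_bounds_of_le n (by simp; omega) k (by simp; omega) M (by simp; omega)
      (by rwa [show n - 1 - k - M = r by omega])
    rw [show n - 1 - k - M = r by omega] at h
    obtain ⟨h1, h2⟩ := h
    set U : ℚ := max ((k : ℚ) + (n - 1) / k) (M + 2 + (k - 1) / (M + 1)) with hU
    have hUa : (k : ℝ) + (n - 1) / k ≤ (U : ℝ) := by
      have : (k : ℚ) + (n - 1) / k ≤ U := le_max_left _ _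
      exact_mod_cast this
    refine ⟨U, U / ((4 * n ^ 2 - 5) / 10), hUa, ?_, ?_, ?_, ?_, ?_⟩
    · have : (((M : ℚ) + 2 + (k - 1) / (M + 1) : ℚ) : ℝ) ≤ U := Rat.cast_le.mpr (le_max_right _ _)
      push_cast at this
      exact this
    · rw [div_mul_cancel₀ _ hρ.ne']
    · exact div_pos (hUa0.trans_le hUa) hρ
    · exact_mod_cast h1
    · exact_mod_cast h2
  have hn16R : (16 : ℝ) ≤ n := by exact_mod_cast hn16
  have hM0 : (0 : ℝ) ≤ M := M.cast_nonneg
  have hr0 : (0 : ℝ) ≤ r := r.cast_nonneg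
  have hsumR : (n : ℝ) = 1 + k + M + r := by exact_mod_cast hsum
  have hUb0 : (M : ℝ) + 2 ≤ (M : ℝ) + 2 + (k - 1) / (M + 1) := by
    have : 0 ≤ ((k : ℝ) - 1) / (M + 1) := div_nonneg (by linarith) (by linarith)
    linarith
  by_cases hab : (k : ℝ) + (n - 1) / k ≤ (M : ℝ) + 2 + (k - 1) / (M + 1)
  · set U := (M : ℝ) + 2 + (k - 1) / (M + 1) with hU
    have hUL : U = U / ((4 * n ^ 2 - 5) / 10) * ((4 * n ^ 2 - 5) / 10) := by
      rw [div_mul_cancel₀ _ hρ.ne']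
    set L := U / ((4 * n ^ 2 - 5) / 10) with hL
    have hL0 : 0 < L := div_pos (by linarith) hρ
    have hL1 : L < 1 := by
      rw [hL, div_lt_one hρ]
      have : ((k : ℝ) - 1) / (M + 1) ≤ k - 1 := div_le_self (by linarith) (by linarith)
      nlinarith
    refine ⟨U, L, hab, le_rfl, hUL, hL0, hL1, ?_⟩
    rcases le_or_gt ((M : ℝ) * (L / (1 - L))) (1 - L) with hA | hA
    · exact Or.inl hA
    refine Or.inr ⟨hA, ?_⟩
    have hM1 : (1 : ℝ) ≤ M := by
      rcases Nat.eq_zero_or_pos M with h0 | h0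
      · rw [h0, Nat.cast_zero, zero_mul] at hA
        linarith
      · exact_mod_cast h0
    -- For k = 1 there is no other branch: the last two terms cancel and the first is negative.
    rcases hk.eq_or_lt with hk1 | hk2
    · subst hk1
      have hr0 : r = 0 := by simpa using hr
      subst hr0
      have : 1 / (1 - L - M * (L / (1 - L))) < 0 := one_div_neg.mpr (by linarith)
      refine ⟨by simpa using hL1, ?_⟩
      have e : (((1 : ℕ) : ℝ) - 2) / (1 - L) + 1 / (1 - L - ((0 : ℕ) : ℝ) * (L / (1 - L))) = 0 := by
        push_cast
        ring
      rw [e, Nat.cast_one]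
      linarith
    · exact spectral_bounds_of_branch_bound hn16R (by exact_mod_cast hk2) hM1 hr0 hsumR hU hUL
        hL0 hL1 hA
  · push Not at hab
    have hk2 : (2 : ℝ) ≤ k := by
      rcases hk.eq_or_lt with hk1 | hk2
      · subst hk1
        have hr0 : r = 0 := by simpa using hr
        subst hr0
        push_cast at hab hsumR
        rw [sub_self, zero_div] at hab
        linarith
      · exact_mod_cast hk2
    have hle := mul_le_of_root_bound (n := n) (by linarith) hk2 hM0 (by linarith) (by linarith)
    have hL0 : 0 < ((k : ℝ) + (n - 1) / k) / ((4 * n ^ 2 - 5) / 10) := div_pos hUa0 hρ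
    have h := mul_div_one_sub_le hL0 hM0 (by
      rw [div_mul_eq_mul_div, div_le_one hρ]
      exact hle)
    exact ⟨_, _, le_rfl, hab.le, (div_mul_cancel₀ _ hρ.ne').symm, hL0, h.1, Or.inl h.2⟩

/-- The expression is convex in m, hence at most its values k + 1 at m = 0 and that at m = M. -/
theorem add_two_add_div_le {k m M U : ℝ} (hm : 0 ≤ m) (hmM : m ≤ M)
    (h1 : k + 1 ≤ U) (h2 : M + 2 + (k - 1) / (M + 1) ≤ U) : m + 2 + (k - 1) / (m + 1) ≤ U := by
  rcases le_total k (m + 2) with h | h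
  · refine le_trans ?_ h2
    have e : M + 2 + (k - 1) / (M + 1) - (m + 2 + (k - 1) / (m + 1)) =
        (M - m) * ((m + 1) * (M + 1) - (k - 1)) / ((m + 1) * (M + 1)) := by
      have : M + 1 ≠ 0 := by linarith
      field_simp
      ring
    have h3 : 0 ≤ (M - m) * ((m + 1) * (M + 1) - (k - 1)) / ((m + 1) * (M + 1)) := by
      apply div_nonneg
      · apply mul_nonneg <;> nlinarith
      · apply mul_nonneg <;> linarith
    linarith
  · have : (k - 1) / (m + 1) ≤ k - 1 - m := by
      rw [div_le_iff₀ (by linarith)]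
      nlinarith
    linarith

/-! ### Combination of the bounds. -/

/-- The extreme Laplacian eigenvalues of a tree with a vertex of eccentricity at most two. -/
theorem SimpleGraph.IsSpiderCenter.exists_lapEigenvalue_bounds {V : Type*} [Fintype V]
    [DecidableEq V] {T : SimpleGraph V} [DecidableRel T.Adj] {v : V} (h : T.IsSpiderCenter v)
    (hn : 6 ≤ Fintype.card V) (hk : 1 ≤ T.degree v) :
    ∃ L : ℝ, 0 < L ∧ L ≤ lapEigenvalue T (Fintype.card V - 2) ∧
      lapEigenvalue T 0 ≤ L * ((4 * (Fintype.card V : ℝ) ^ 2 - 5) / 10) := by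
  have hne : (T.neighborFinset v).Nonempty := by
    rwa [← Finset.card_pos, SimpleGraph.card_neighborFinset_eq_degree]
  obtain ⟨d, hd, hmax⟩ := (T.neighborFinset v).exists_max_image (T.numLeaves v) hne
  set s := (T.neighborFinset v).erase d with hs
  set r := ∑ c ∈ s, T.numLeaves v c with hr
  have hscard : s.card = T.degree v - 1 := by
    rw [hs, Finset.card_erase_of_mem hd, SimpleGraph.card_neighborFinset_eq_degree]
  have hsum : Fintype.card V = 1 + T.degree v + T.numLeaves v d + r := by
    rw [h.card_eq, ← Finset.add_sum_erase _ _ hd, ← add_assoc]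
  have hrle : r ≤ (T.degree v - 1) * T.numLeaves v d := by
    rw [← hscard, ← smul_eq_mul]
    exact Finset.sum_le_card_nsmul _ _ _ fun c hc => hmax c (Finset.mem_of_mem_erase hc)
  obtain ⟨U, L, hUa, hUb, hUL, hL0, hL1, hcase⟩ := exists_spectral_bounds hn hk hsum hrle
  have hkR : (1 : ℝ) ≤ T.degree v := by exact_mod_cast hk
  have ht : 0 < L / (1 - L) := div_pos hL0 (by linarith)
  refine ⟨L, hL0, ?_, ?_⟩
  · rcases hcase with hA | ⟨hB1, hB2, hB3⟩
    · refine h.le_lapEigenvalue_of_numLeaves_le hL1 (fun c hc => ?_) (by omega)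
      refine le_trans ?_ hA
      gcongr
      exact hmax c hc
    · have hrR : ∑ c ∈ s, (T.numLeaves v c : ℝ) * (L / (1 - L)) = r * (L / (1 - L)) := by
        rw [← Finset.sum_mul, hr]
        push_cast
        rfl
      have hnn : ∀ c ∈ s, 0 ≤ (T.numLeaves v c : ℝ) * (L / (1 - L)) := fun c _ => by positivity
      refine h.le_lapEigenvalue_of_sum_le hL1 hd (by linarith) (fun c hc => ?_) ?_ (by omega)
      · have := Finset.single_le_sum hnn hc
        linarith
      · rw [← Finset.add_sum_erase _ _ hd]
        -- Among the branches other than `d`, the worst case puts all `r` leaves on one.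
        have hconv := Finset.sum_one_div_sub_le s _ hnn (by rwa [hrR])
        rw [hrR, hscard, Nat.cast_sub hk, Nat.cast_one, sub_sub, one_add_one_eq_two] at hconv
        linarith
  · rw [← hUL]
    refine lapEigenvalue_le T (h.form_le hk hUa fun c hc => ?_) (by omega)
    refine add_two_add_div_le (Nat.cast_nonneg _) (by exact_mod_cast hmax c hc) ?_ hUb
    refine le_trans ?_ hUa
    have hdeg : (T.degree v : ℝ) + 1 ≤ Fintype.card V := by
      have := T.degree_lt_card_verts v
      exact_mod_cast this
    gcongr
    rw [le_div_iff₀ (by linarith)]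
    linarith

theorem theorem4p3 {V : Type*} [Fintype V] (T : SimpleGraph V) (hT : T.IsTree)
    (hn : 6 ≤ Fintype.card V)
    (hD : (eccentricityGeThree T).ncard ≤ Fintype.card V - 1) :
    laplacianSpectralRatio T <
      laplacianSpectralRatio (SimpleGraph.pathGraph (Fintype.card V)) := by
  classical
  obtain ⟨v, hv⟩ : ∃ v, v ∉ eccentricityGeThree T := by
    by_contra! hall
    rw [Set.eq_univ_of_forall hall, Set.ncard_univ, Nat.card_eq_fintype_card] at hD
    omega
  have hv' : ∀ x, T.dist x v < 3 := by
    simpa [eccentricityGeThree] using hv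
  have : Nontrivial V := Fintype.one_lt_card_iff_nontrivial.mp (by omega)
  have hk : 1 ≤ T.degree v := hT.connected.preconnected.degree_pos_of_nontrivial v
  obtain ⟨L, hL0, hL, hU⟩ := (hT.isSpiderCenter hv').exists_lapEigenvalue_bounds hn hk
  refine lt_of_le_of_lt ?_ (lt_laplacianSpectralRatio_pathGraph hn)
  rw [laplacianSpectralRatio, div_le_iff₀ (hL0.trans_le hL)]
  refine hU.trans ?_
  rw [mul_comm]
  have hnR : (6 : ℝ) ≤ Fintype.card V := by exact_mod_cast hn
  gcongr
  nlinarith
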